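/- Let $T$ be a tournament on a finite set $V$ of $n = 2^k$ players, $k \ge 0$; that is, for any two distinct players $u, w$ exactly one of "$u$ beats $w$" and "$w$ beats $u$" holds, and no player beats himself. The Copeland score $out(v)$ of a player $v$ is the number of players that $v$ beats. A player $v$ is an SE winner if there is a seeding, i.e. an assignment of the players to the $n$ positions of a balanced single-elimination bracket, under which $v$ wins the resulting single-elimination tournament, each match being won by the player who beats the other one in $T$. - The Copeland set of $T$ is the set of players of maximum Copeland score. - A tournament is transitive if its players can be labeled $1, \dots, n$ so that $i$ beats $j$ whenever $i < j$. The Slater set of $T$ is the set of players that are labeled $1$ in some transitive tournament on $V$ obtained from $T$ by flipping the minimum possible number of edges. - For $n \ge 2$, the Markov set of $T$ is the set of players of maximum probability in the stationary distribution $p$, $Qp = p$, of the Markov chain with (column-stochastic) transition matrix $Q = (q_{ij})$, where $q_{ii} = out(i)/(n-1)$ and, for $i \ne j$, $q_{ij} = 1/(n-1)$ if $i$ beats $j$ and $q_{ij} = 0$ otherwise. For $n = 1$ it consists of the only player. - The bipartisan set of $T$ is the support of the maximal lottery of $T$, i.e. of the mixed strategy $p$ for which $(p,p)$ is a Nash equilibrium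 of the symmetric zero-sum game on $V$ with payoff $1$ to player $i$ against $j$ if $i$ beats $j$, $-1$ if $j$ beats $i$, and $0$ if $i = j$. Then every player in the Copeland set, the Slater set, or the Markov set of $T$ is an SE winner. Moreover, every player of the bipartisan set whose Copeland score is the highest among all players of the bipartisan set is an SE winner. -/

import Mathlib

/-- A tournament on the player set `V`: a complete oriented graph. `T.beats u w` means that the
edge points from `u` to `w`, i.e. that `u` would win the match between `u` and `w`. -/
structure Tournament (V : Type*) where
  beats : V → V → Prop
  irrefl : ∀ u, ¬ beats u u
  asymm : ∀ u w, beats u w → ¬ beats w u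
  total : ∀ u w, u ≠ w → beats u w ∨ beats w u

noncomputable section

namespace Tournament

open scoped Classical in
/-- The winner of the match between `u` and `w`. -/
def matchWinner {V : Type*} (T : Tournament V) (u w : V) : V :=
  if T.beats u w then u else w

/-- The winner of the balanced single-elimination tournament with `k` rounds on `2 ^ k` players
listed in the order of the seeding `s`: in every round the players in the positions `2 i` and
`2 i + 1` meet, and the winner moves to position `i` of the next round, until one player is
left. -/
def seOutcome {V : Type*} (T : Tournament V) : (k : ℕ) → (Fin (2 ^ k) → V) → V
  | 0, s => s ⟨0, by norm_num⟩
  | k + 1, s => T.seOutcome k fun i =>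
      T.matchWinner
        (s ⟨2 * (i : ℕ), by have := i.isLt; rw [pow_succ]; omega⟩)
        (s ⟨2 * (i : ℕ) + 1, by have := i.isLt; rw [pow_succ]; omega⟩)

/-- `v` is an SE winner: there is a seeding of all the players (a bijection from the `2 ^ k`
positions to `V`) under which `v` wins the resulting balanced single-elimination tournament. -/
def IsSEWinner {V : Type*} (T : Tournament V) (v : V) : Prop :=
  ∃ (k : ℕ) (s : Fin (2 ^ k) ≃ V), T.seOutcome k s = v

variable {V : Type*} [Fintype V]

open scoped Classical in
/-- The out-degree (Copeland score) of `v`: the number of players that `v` beats. -/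
def outDegree (T : Tournament V) (v : V) : ℕ :=
  (Finset.univ.filter fun u => T.beats v u).card

/-- The Copeland set: the players of maximum out-degree. -/
def copelandSet (T : Tournament V) : Set V :=
  {v | ∀ u, T.outDegree u ≤ T.outDegree v}

/-- `e` labels the players with `0, …, n - 1` in such a way that every player beats all the
players with a larger label. -/
def IsTransitiveLabeling (T : Tournament V) (e : V ≃ Fin (Fintype.card V)) : Prop :=
  ∀ u w, e u < e w → T.beats u w

/-- A tournament is transitive if it has a transitive labeling. -/
def IsTransitive (T : Tournament V) : Prop :=
  ∃ e, T.IsTransitiveLabeling e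

open scoped Classical in
/-- The number of edges of `T` that have to be flipped to turn `T` into `T'`. -/
def flips (T T' : Tournament V) : ℕ :=
  (Finset.univ.filter fun q : V × V => T.beats q.1 q.2 ∧ T'.beats q.2 q.1).card

/-- `T'` is a transitive tournament that arises from `T` by flipping as few edges as possible. -/
def IsClosestTransitive (T T' : Tournament V) : Prop :=
  T'.IsTransitive ∧ ∀ T'' : Tournament V, T''.IsTransitive → T.flips T' ≤ T.flips T''

/-- The Slater set: the players that carry the first label in a transitive tournament which
arises from `T` by flipping as few edges as possible. -/
def slaterSet (T : Tournament V) : Set V :=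
  {v | ∃ T', T.IsClosestTransitive T' ∧ ∃ e, T'.IsTransitiveLabeling e ∧ (e v : ℕ) = 0}

open scoped Classical in
/-- The transition matrix of the "winner stays" Markov chain, in which a player chosen uniformly
at random among the other `n - 1` players plays the previous winner. The entry in row `i` and
column `j` is the probability that `i` is the next winner if `j` is the current one, so that the
columns sum to `1`. If there is only one player, he remains the winner. -/
def markovMatrix (T : Tournament V) : Matrix V V ℝ := fun i j =>
  if i = j then
    if Fintype.card V = 1 then 1 else (T.outDegree i : ℝ) / ((Fintype.card V : ℝ) - 1)
  else if T.beats i j then 1 / ((Fintype.card V : ℝ) - 1)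
  else 0

/-- `p` is a stationary distribution of the "winner stays" Markov chain. -/
def IsStationary (T : Tournament V) (p : V → ℝ) : Prop :=
  p ∈ stdSimplex ℝ V ∧ T.markovMatrix.mulVec p = p

/-- The Markov set: the players of maximum probability in the stationary distribution. -/
def markovSet (T : Tournament V) : Set V :=
  {v | ∃ p, T.IsStationary p ∧ ∀ u, p u ≤ p v}

open scoped Classical in
/-- The skew-symmetric tournament matrix: `1` for a win, `-1` for a loss, `0` on the diagonal. -/
def payoffMatrix (T : Tournament V) : Matrix V V ℝ := fun i j =>
  if T.beats i j then 1 else if T.beats j i then -1 else 0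

/-- The expected payoff of the row player in the zero-sum game given by the tournament matrix,
when the row player uses the mixed strategy `p` and the column player the mixed strategy `q`. -/
def payoff (T : Tournament V) (p q : V → ℝ) : ℝ :=
  ∑ i, ∑ j, p i * T.payoffMatrix i j * q j

/-- `(p, q)` is a Nash equilibrium (in mixed strategies) of the zero-sum game given by the
tournament matrix: neither the row player, who receives `payoff p q`, nor the column player, who
pays it, gains by changing the strategy alone. -/
def IsNashEquilibrium (T : Tournament V) (p q : V → ℝ) : Prop :=
  p ∈ stdSimplex ℝ V ∧ q ∈ stdSimplex ℝ V ∧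
    (∀ p' ∈ stdSimplex ℝ V, T.payoff p' q ≤ T.payoff p q) ∧
    (∀ q' ∈ stdSimplex ℝ V, T.payoff p q ≤ T.payoff p q')

/-- A maximal lottery is a strategy `p` such that `(p, p)` is a Nash equilibrium. -/
def IsMaximalLottery (T : Tournament V) (p : V → ℝ) : Prop :=
  T.IsNashEquilibrium p p

/-- The bipartisan set: the support of the maximal lottery. -/
def bipartisanSet (T : Tournament V) : Set V :=
  {v | ∃ p, T.IsMaximalLottery p ∧ 0 < p v}

end Tournament

end

/-!
Every player `v` in question has two properties: he is a *king* (every other player loses to `v` or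
to somebody whom `v` beats), and he beats at least half of the other players. A king who does so
wins some seeding (`isSEWinner_of_isKingIn`), by induction on the number of rounds. Let `A` be
the set of players that lose to `v`, and `B` the set of players that beat `v`. Play a maximal family
of disjoint matches in which a member of `A` beats a member of `B`; let `v` beat one of the unmatched
members of `A`, who exist as `A` is larger than `B`; and pair the remaining players so that at most
one match is between `A` and `B`. By maximality, no unmatched member of `A` beats an unmatched
member of `B`, so the members of `B` that survive the round lose to members of `A` that survive,
and `v` remains a king. Counting shows that `v` still beats at least half of the other survivors.

A player `v` fails to be a king only if he is *covered*: some `u` beats `v` and everybody whom `v`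
beats. So it is enough that the four solutions select no covered player, and only players with at
least as many wins as losses:

* Copeland: a covering player has a larger score, and the average score is `(n - 1) / 2`.
* Slater: in a closest transitive tournament, exchanging the first player with one who covers him
  would save a flip, and moving him to the last place must not save any.
* Markov: stationarity says `p v * (losses of v) = ∑ p w` over the players `w` beaten by `v`.
  For a `v` with the largest `p v` this bounds the losses by the wins, and the same identity for a
  `u` that covers `v` gives `p u > p v`.
* Bipartisan: against a maximal lottery `p`, every player has expected payoff at most `0`, with
  equality on the support, while a covering player would get strictly more than the covered one.
  Averaging the expected payoffs over all opponents gives a player of the support with at least as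
  many wins as losses.
-/

namespace Tournament

open Finset

open scoped Classical

section Seeding

variable {V : Type*}

/-! ### Pairing players for one round -/

/-- `T.IsRound S W`: the players of `S` can be paired in such a way that `W` is the set of winners
of the matches. -/
inductive IsRound (T : Tournament V) : Finset V → Finset V → Prop
  | empty : IsRound T ∅ ∅
  | cons {S W : Finset V} {a b : V} : IsRound T S W → a ∉ S → b ∉ S → T.beats a b →
      IsRound T (insert a (insert b S)) (insert a W)

/-- `v` is a king of `S`: every other player of `S` loses to `v` or to a player of `S` who loses
to `v`. -/
def IsKingIn (T : Tournament V) (S : Finset V) (v : V) : Prop :=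
  ∀ u ∈ S, u ≠ v → T.beats v u ∨ ∃ w ∈ S, T.beats v w ∧ T.beats w u

variable {T : Tournament V}

theorem ne_of_beats {a b : V} (h : T.beats a b) : a ≠ b := by
  rintro rfl
  exact T.irrefl _ h

theorem IsRound.subset {S W : Finset V} (h : T.IsRound S W) : W ⊆ S := by
  induction h with
  | empty => simp
  | cons _ _ _ _ ih => grind

theorem IsRound.two_mul_card {S W : Finset V} (h : T.IsRound S W) : 2 * #W = #S := by
  induction h with
  | empty => simp
  | @cons S W a b hr ha hb hab ih =>
    have := ne_of_beats hab
    have haW : a ∉ W := fun h => ha (hr.subset h)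
    rw [card_insert_of_notMem haW, card_insert_of_notMem (by simp [ha, this]),
      card_insert_of_notMem hb]
    omega

theorem IsRound.union {S S' W W' : Finset V} (h : T.IsRound S W) (h' : T.IsRound S' W')
    (hd : Disjoint S S') : T.IsRound (S ∪ S') (W ∪ W') := by
  induction h with
  | empty => simpa using h'
  | cons _ ha hb hab ih =>
    simp only [disjoint_insert_left] at hd
    rw [insert_union, insert_union, insert_union]
    exact .cons (ih hd.2.2) (by simp [ha, hd.1]) (by simp [hb, hd.2.1]) hab

theorem isRound_pair {a b : V} (h : T.beats a b) : T.IsRound {a, b} {a} :=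
  .cons .empty (by simp) (by simp) h

theorem exists_isRound_pair {a b : V} (h : a ≠ b) : ∃ W, T.IsRound {a, b} W := by
  rcases T.total a b h with h | h
  · exact ⟨_, isRound_pair h⟩
  · exact ⟨_, pair_comm b a ▸ isRound_pair h⟩

/-- A round determines the opponent of each winner. -/
theorem IsRound.exists_loser {S W : Finset V} (h : T.IsRound S W) :
    ∃ l : V → V, Set.InjOn l W ∧ ∀ w ∈ W, l w ∈ S ∧ l w ∉ W ∧ T.beats w (l w) := by
  induction h with
  | empty => exact ⟨id, by simp⟩
  | @cons S W a b hr ha hb hab ih =>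
    obtain ⟨l, hl, hlw⟩ := ih
    have hne := ne_of_beats hab
    have hs := hr.subset
    refine ⟨fun w => if w = a then b else l w, ?_, ?_⟩
    · intro x hx y hy hxy
      simp only [coe_insert, Set.mem_insert_iff, mem_coe] at hx hy
      have := @hl x
      grind
    · grind

theorem exists_isRound_of_even (T : Tournament V) (S : Finset V) (hS : Even #S) :
    ∃ W, T.IsRound S W := by
  induction S using Finset.strongInduction with
  | H S ih =>
    rcases S.eq_empty_or_nonempty with rfl | hne
    · exact ⟨∅, .empty⟩
    · have h1 : 1 < #S := by
        have := hne.card_pos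
        grind
      obtain ⟨a, ha, b, hb, hab⟩ := one_lt_card.1 h1
      have hsub : ({a, b} : Finset V) ⊆ S := by grind
      have hc := card_sdiff_add_card_eq_card hsub
      rw [card_pair hab] at hc
      obtain ⟨W, hW⟩ := ih (S \ {a, b}) (sdiff_ssubset hsub (by simp)) (by grind)
      obtain ⟨W', hW'⟩ := exists_isRound_pair (T := T) hab
      refine ⟨W ∪ W', ?_⟩
      have := hW.union hW' sdiff_disjoint
      rwa [sdiff_union_of_subset hsub] at this

/-- Pairing up as many players as possible inside `X` makes at least half of them, up to rounding,
survive the round. -/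
theorem exists_isRound_union (T : Tournament V) (X Y : Finset V) (hd : Disjoint X Y)
    (he : Even (#X + #Y)) : ∃ W, T.IsRound (X ∪ Y) W ∧ #X ≤ 2 * #(W ∩ X) + 1 := by
  induction X using Finset.strongInduction with
  | H X ih =>
    by_cases h1 : 1 < #X
    · obtain ⟨a, ha, b, hb, hab⟩ := one_lt_card.1 h1
      have hsub : ({a, b} : Finset V) ⊆ X := by grind
      have hc := card_sdiff_add_card_eq_card hsub
      rw [card_pair hab] at hc
      obtain ⟨W, hW, hWc⟩ := ih (X \ {a, b}) (sdiff_ssubset hsub (by simp))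
        (hd.mono_left sdiff_subset) (by grind)
      obtain ⟨W', hW'⟩ := exists_isRound_pair (T := T) hab
      have hdis : Disjoint (X \ {a, b} ∪ Y) {a, b} :=
        disjoint_union_left.2 ⟨sdiff_disjoint, (hd.mono_left hsub).symm⟩
      refine ⟨W ∪ W', ?_, ?_⟩
      · have := hW.union hW' hdis
        rwa [union_right_comm, sdiff_union_of_subset hsub] at this
      · have h2 := hW'.two_mul_card
        rw [card_pair hab] at h2
        have h3 : (W ∩ (X \ {a, b})) ∪ W' ⊆ (W ∪ W') ∩ X := by
          have := hW'.subset
          grind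
        have h4 : Disjoint (W ∩ (X \ {a, b})) W' :=
          sdiff_disjoint.mono inter_subset_right hW'.subset
        have h5 := card_le_card h3
        rw [card_union_of_disjoint h4] at h5
        omega
    · obtain ⟨W, hW⟩ := T.exists_isRound_of_even (X ∪ Y) (by rwa [card_union_of_disjoint hd])
      exact ⟨W, hW, by omega⟩

/-- A maximal family of disjoint matches that are won by a player of `A` against a player
of `B`. -/
theorem exists_maximal_isRound (T : Tournament V) (A B : Finset V) (hd : Disjoint A B) :
    ∃ A₀ ⊆ A, ∃ B₀ ⊆ B, T.IsRound (A₀ ∪ B₀) A₀ ∧ ∀ a ∈ A \ A₀, ∀ b ∈ B \ B₀, ¬ T.beats a b := by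
  induction A using Finset.strongInduction generalizing B with
  | H A ih =>
    by_cases h : ∃ a ∈ A, ∃ b ∈ B, T.beats a b
    · obtain ⟨a, ha, b, hb, hab⟩ := h
      obtain ⟨A₀, hA, B₀, hB, hr, hmax⟩ := ih (A.erase a) (erase_ssubset ha) (B.erase b)
        (hd.mono (erase_subset _ _) (erase_subset _ _))
      have hdab := disjoint_left.1 hd
      refine ⟨insert a A₀, by grind, insert b B₀, by grind, ?_, by grind⟩
      rw [insert_union, union_insert]
      exact .cons hr (by grind) (by grind) hab
    · push Not at h
      exact ⟨∅, by simp, ∅, by simp, by simpa using IsRound.empty, by simpa using h⟩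

/-! ### A king with at least as many wins as losses wins some seeding -/

/-- The inequality `#S ≤ 2 * #{u ∈ S | T.beats v u} + 1` says that `v` has at least as many wins as
losses in `S`. -/
theorem IsKingIn.exists_isRound {S : Finset V} {v : V} {k : ℕ} (hv : v ∈ S)
    (hS : #S = 2 ^ (k + 1)) (hk : T.IsKingIn S v) (ho : #S ≤ 2 * #{u ∈ S | T.beats v u} + 1) :
    ∃ W, T.IsRound S W ∧ v ∈ W ∧ T.IsKingIn W v ∧ #W ≤ 2 * #{u ∈ W | T.beats v u} + 1 := by
  set A := {u ∈ S | T.beats v u} with hA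
  set B := {u ∈ S | T.beats u v} with hB
  have hvA : v ∉ A := by simp [hA, T.irrefl]
  have hvB : v ∉ B := by simp [hB, T.irrefl]
  have hAB : Disjoint A B :=
    disjoint_left.2 fun x hx hx' => T.asymm v x (mem_filter.1 hx).2 (mem_filter.1 hx').2
  have hSu : S = insert v (A ∪ B) := by
    ext x
    have := T.total v x
    grind
  have hcard : #S = #A + #B + 1 := by
    conv_lhs => rw [hSu]
    rw [card_insert_of_notMem (by simp [hvA, hvB]), card_union_of_disjoint hAB]
  obtain ⟨A₀, hA₀, B₀, hB₀, hr₀, hmax⟩ := T.exists_maximal_isRound A B hAB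
  have hd₀ : Disjoint A₀ B₀ := hAB.mono hA₀ hB₀
  have hm := hr₀.two_mul_card
  rw [card_union_of_disjoint hd₀] at hm
  have hcA := card_sdiff_add_card_eq_card hA₀
  have hcB := card_sdiff_add_card_eq_card hB₀
  have hpos : 0 < 2 ^ k := by positivity
  rw [pow_succ] at hS
  obtain ⟨a, ha⟩ : (A \ A₀).Nonempty := card_pos.1 (by omega)
  have hva : T.beats v a := (mem_filter.1 (mem_sdiff.1 ha).1).2
  have hce := card_erase_add_one ha
  have hdX : Disjoint ((A \ A₀).erase a) (B \ B₀) :=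
    hAB.mono ((erase_subset _ _).trans sdiff_subset) sdiff_subset
  obtain ⟨W, hW, hWc⟩ := T.exists_isRound_union ((A \ A₀).erase a) (B \ B₀) hdX
    ⟨2 ^ k - 1 - #A₀, by omega⟩
  have hWs := hW.subset
  have hdab := disjoint_left.1 hAB
  have hR : T.IsRound S ({v} ∪ A₀ ∪ W) := by
    have h := ((isRound_pair hva).union hr₀ ?_).union hW ?_
    · convert h using 1
      grind
    · refine disjoint_left.2 ?_
      grind
    · refine disjoint_left.2 ?_
      grind
  refine ⟨{v} ∪ A₀ ∪ W, hR, by simp, ?_, ?_⟩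
  · intro u hu huv
    by_cases hvu : T.beats v u
    · exact .inl hvu
    · right
      obtain ⟨w, hw, hvw, hwu⟩ := (hk u (hR.subset hu) huv).resolve_left hvu
      exact ⟨w, by grind, hvw, hwu⟩
  · have h2 := hR.two_mul_card
    have h3 : A₀ ∪ (W ∩ (A \ A₀).erase a) ⊆ {u ∈ {v} ∪ A₀ ∪ W | T.beats v u} := by grind
    have h4 := card_le_card h3
    have h5 : Disjoint A₀ (W ∩ (A \ A₀).erase a) := by
      refine disjoint_left.2 ?_
      grind
    rw [card_union_of_disjoint h5] at h4
    rcases A₀.eq_empty_or_nonempty with h0 | h0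
    · -- Without a match between `A` and `B`, the king beats everybody.
      have hA₀c : #A₀ = 0 := card_eq_zero.2 h0
      have hB0 : B = ∅ := by
        refine eq_empty_of_forall_notMem fun b hb => ?_
        obtain ⟨hbS, hbv⟩ := mem_filter.1 hb
        obtain ⟨w, hw, hvw, hwb⟩ := (hk b hbS (ne_of_beats hbv)).resolve_left (T.asymm b v hbv)
        have hB₀ : B₀ = ∅ := card_eq_zero.1 (by omega)
        exact hmax w (by grind) b (by grind) hwb
      have h6 : W ∩ (A \ A₀).erase a = W := inter_eq_left.2 (by grind)
      have h7 := hW.two_mul_card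
      rw [card_union_of_disjoint hdX] at h7
      rw [h6] at h4
      have hBc : #B = 0 := card_eq_zero.2 hB0
      omega
    · have := h0.card_pos
      omega

/-- A seeding of the winners of a round extends to a seeding of all the players of the round. -/
theorem IsRound.exists_seeding {S W : Finset V} (h : T.IsRound S W) {k : ℕ}
    (s : Fin (2 ^ k) → V) (hs : Function.Injective s) (hsW : ∀ i, s i ∈ W) :
    ∃ s' : Fin (2 ^ (k + 1)) → V, Function.Injective s' ∧ (∀ i, s' i ∈ S) ∧
      T.seOutcome (k + 1) s' = T.seOutcome k s := by
  obtain ⟨l, hl, hlw⟩ := h.exists_loser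
  have hlt : ∀ i : Fin (2 ^ (k + 1)), (i : ℕ) / 2 < 2 ^ k := fun i => by
    have := i.isLt
    have := pow_succ 2 k
    omega
  refine ⟨fun i => if (i : ℕ) % 2 = 0 then s ⟨i / 2, hlt i⟩ else l (s ⟨i / 2, hlt i⟩),
    ?_, ?_, ?_⟩
  · intro i j hij
    have hd : (i : ℕ) % 2 = j % 2 ∧ (⟨i / 2, hlt i⟩ : Fin (2 ^ k)) = ⟨j / 2, hlt j⟩ := by
      by_cases hi : (i : ℕ) % 2 = 0 <;> by_cases hj : (j : ℕ) % 2 = 0 <;>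
        simp only [hi, hj, if_true, if_false] at hij
      · exact ⟨by omega, hs hij⟩
      · exact absurd (hij ▸ hsW _) (hlw _ (hsW _)).2.1
      · exact absurd (hij ▸ hsW _) (hlw _ (hsW _)).2.1
      · exact ⟨by omega, hs (hl (hsW _) (hsW _) hij)⟩
    have h2 := Fin.mk.inj_iff.1 hd.2
    ext
    omega
  · intro i
    dsimp only
    split_ifs
    · exact h.subset (hsW _)
    · exact (hlw _ (hsW _)).1
  · rw [seOutcome]
    congr 1
    ext i
    have h1 : (2 * (i : ℕ) + 1) / 2 = i := by omega
    simp [h1, Nat.add_mod, matchWinner, (hlw _ (hsW i)).2.2]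

theorem IsKingIn.exists_seeding {k : ℕ} {S : Finset V} {v : V} (hv : v ∈ S) (hS : #S = 2 ^ k)
    (hk : T.IsKingIn S v) (ho : #S ≤ 2 * #{u ∈ S | T.beats v u} + 1) :
    ∃ s : Fin (2 ^ k) → V, Function.Injective s ∧ (∀ i, s i ∈ S) ∧ T.seOutcome k s = v := by
  induction k generalizing S with
  | zero =>
    refine ⟨fun _ => v, ?_, fun _ => hv, rfl⟩
    intro i j _
    ext
    have := i.isLt
    have := j.isLt
    omega
  | succ k ih =>
    obtain ⟨W, hW, hvW, hkW, hoW⟩ := hk.exists_isRound hv hS ho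
    have hc := hW.two_mul_card
    obtain ⟨s, hs, hsW, hsv⟩ := ih hvW (by rw [hS, pow_succ] at hc; omega) hkW hoW
    obtain ⟨s', hs', hsS, hso⟩ := hW.exists_seeding s hs hsW
    exact ⟨s', hs', hsS, hso.trans hsv⟩

end Seeding

theorem payoffMatrix_swap {V : Type*} (T : Tournament V) (u v : V) :
    T.payoffMatrix u v = - T.payoffMatrix v u := by
  have := T.asymm v u
  unfold payoffMatrix
  split_ifs <;> first | tauto | simp

variable {V : Type*} [Fintype V] {T : Tournament V}

theorem isSEWinner_of_isKingIn {k : ℕ} (hV : Fintype.card V = 2 ^ k) {v : V}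
    (hk : T.IsKingIn univ v) (ho : Fintype.card V ≤ 2 * T.outDegree v + 1) : T.IsSEWinner v := by
  obtain ⟨s, hs, -, hsv⟩ := hk.exists_seeding (k := k) (mem_univ v) hV ho
  refine ⟨k, .ofBijective s ((Fintype.bijective_iff_injective_and_card s).2 ⟨hs, ?_⟩), hsv⟩
  simp [hV]

/-! ### Covered players and score counting -/

/-- A player is a king if no `u` *covers* him, i.e. beats both him and all players that he beats. -/
theorem isKingIn_univ_of_not_covered {v : V}
    (h : ∀ u, T.beats u v → ¬ ∀ w, T.beats v w → T.beats u w) : T.IsKingIn univ v := by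
  intro u _ huv
  by_contra! hc
  obtain ⟨hvu, hw⟩ := hc
  refine h u ((T.total u v huv).resolve_right hvu) fun w hvw => ?_
  refine (T.total w u ?_).resolve_left (hw w (mem_univ w) hvw)
  rintro rfl
  exact hvu hvw

theorem outDegree_lt_of_covers {u v : V} (huv : T.beats u v)
    (h : ∀ w, T.beats v w → T.beats u w) : T.outDegree v < T.outDegree u := by
  refine card_lt_card (ssubset_iff_of_subset (fun w => ?_) |>.2 ⟨v, ?_⟩)
  · simpa using h w
  · simpa [T.irrefl] using huv

theorem card_losses_add_outDegree (T : Tournament V) (v : V) :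
    #{u | T.beats u v} + T.outDegree v + 1 = Fintype.card V := by
  have hd : Disjoint ({u | T.beats u v} : Finset V) ({u | T.beats v u} : Finset V) :=
    disjoint_filter.2 fun u _ => T.asymm u v
  have hu : insert v (({u | T.beats u v} : Finset V) ∪ ({u | T.beats v u} : Finset V)) = univ := by
    ext u
    have := T.total v u
    grind
  rw [outDegree, ← card_union_of_disjoint hd, ← card_insert_of_notMem (a := v), hu, card_univ]
  simp [T.irrefl]

theorem sum_payoffMatrix (T : Tournament V) (v : V) :
    ∑ u, T.payoffMatrix v u = 2 * T.outDegree v + 1 - Fintype.card V := by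
  have h : ∀ u, T.payoffMatrix v u =
      (if T.beats v u then 1 else 0) - (if T.beats u v then 1 else 0) := by
    intro u
    have := T.asymm v u
    unfold payoffMatrix
    split_ifs <;> first | tauto | simp
  simp_rw [h, sum_sub_distrib, sum_boole, ← T.card_losses_add_outDegree v, outDegree]
  push_cast
  ring

/-! ### Copeland set -/

theorem isKingIn_of_mem_copelandSet {v : V} (hv : v ∈ T.copelandSet) : T.IsKingIn univ v :=
  isKingIn_univ_of_not_covered fun u huv h =>
    absurd (outDegree_lt_of_covers huv h) (not_lt.2 (hv u))

theorem card_le_of_mem_copelandSet {v : V} (hv : v ∈ T.copelandSet) :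
    Fintype.card V ≤ 2 * T.outDegree v + 1 := by
  by_contra! hc
  -- The payoffs of all ordered pairs cancel, but every row sum would be negative.
  have h0 : ∑ u, ∑ w, T.payoffMatrix u w = 0 := by
    have h1 : ∑ u, ∑ w, T.payoffMatrix u w = - ∑ u, ∑ w, T.payoffMatrix u w := by
      refine (sum_comm (f := fun u w => T.payoffMatrix u w)).trans ?_
      simp_rw [← sum_neg_distrib]
      exact sum_congr rfl fun u _ => sum_congr rfl fun w _ => T.payoffMatrix_swap w u
    linarith
  have h1 : ∑ u, ∑ w, T.payoffMatrix u w < 0 := by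
    refine sum_neg (fun u _ => ?_) ⟨v, mem_univ v⟩
    rw [sum_payoffMatrix]
    have h2 : 2 * T.outDegree u + 1 < Fintype.card V := by
      have := hv u
      omega
    have h3 : ((2 * T.outDegree u + 1 : ℕ) : ℝ) < Fintype.card V := by exact_mod_cast h2
    push_cast at h3
    linarith
  exact h1.ne h0

/-! ### Slater set -/

/-- The edges of `T` that point from a larger to a smaller value of `f`. -/
noncomputable def backEdges (T : Tournament V) (f : V → ℕ) : Finset (V × V) :=
  {q | T.beats q.1 q.2 ∧ f q.2 < f q.1}

/-- The transitive tournament in which the players with smaller `f` beat those with larger `f`. -/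
def ofRank (f : V → ℕ) (hf : Function.Injective f) : Tournament V where
  beats u w := f u < f w
  irrefl _ := lt_irrefl _
  asymm _ _ h := not_lt.2 h.le
  total _ _ h := lt_or_gt_of_ne (hf.ne h)

theorem isTransitive_ofRank (f : V → ℕ) (hf : Function.Injective f) :
    (ofRank f hf).IsTransitive := by
  let _ : LinearOrder V := LinearOrder.lift' f hf
  let e := (Fintype.orderIsoFinOfCardEq V rfl).symm
  exact ⟨e.toEquiv, fun u w h => e.lt_iff_lt.1 h⟩

theorem flips_ofRank (T : Tournament V) (f : V → ℕ) (hf : Function.Injective f) :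
    T.flips (ofRank f hf) = #(T.backEdges f) :=
  congrArg card (filter_congr fun _ _ => Iff.rfl)

/-- The labeling of a closest transitive tournament minimizes the number of backward edges among
all rankings of the players. -/
theorem IsClosestTransitive.card_backEdges_le {T' : Tournament V} (h : T.IsClosestTransitive T')
    {e : V ≃ Fin (Fintype.card V)} (he : T'.IsTransitiveLabeling e) (f : V → ℕ)
    (hf : Function.Injective f) : #(T.backEdges fun u => (e u : ℕ)) ≤ #(T.backEdges f) := by
  suffices hflips : T.flips T' = #(T.backEdges fun u => (e u : ℕ)) from
    hflips ▸ flips_ofRank T f hf ▸ h.2 _ (isTransitive_ofRank f hf)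
  refine congrArg card (filter_congr fun q _ => and_congr_right fun hq => Iff.symm ?_)
  refine ⟨fun h => he _ _ h, fun hb => ?_⟩
  have hne : e q.2 ≠ e q.1 := fun h => T.irrefl q.2 (by rwa [← e.injective h] at hq)
  rcases lt_or_gt_of_ne hne with h' | h'
  · exact h'
  · exact absurd (he _ _ h') (T'.asymm _ _ hb)

/-- Exchanging the first player `v` of a ranking with a player `u` who covers `v` saves a backward
edge. -/
theorem card_backEdges_lt_of_covers {u v : V} (huv : T.beats u v)
    (hcov : ∀ w, T.beats v w → T.beats u w) {f g : V → ℕ} (hf : Function.Injective f)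
    (hfv : f v = 0) (hgu : g u = f v) (hgv : g v = f u) (hg : ∀ w, w ≠ u → w ≠ v → g w = f w) :
    #(T.backEdges g) < #(T.backEdges f) := by
  have hne : u ≠ v := ne_of_beats huv
  have h0 : ∀ w, w ≠ v → 0 < f w := fun w hw =>
    Nat.pos_of_ne_zero fun h => hw (hf (h.trans hfv.symm))
  have hvu := T.asymm u v huv
  have hg' : ∀ w, g w = if w = u then 0 else if w = v then f u else f w := fun w => by
    split_ifs with h h'
    exacts [h ▸ hgu.trans hfv, h' ▸ hgv, hg w h h']
  have huvmem : (u, v) ∈ T.backEdges f := by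
    simpa only [backEdges, mem_filter, mem_univ, true_and, hfv] using ⟨huv, h0 u hne⟩
  -- An edge that becomes backward by the exchange of `u` and `v` is charged to a backward edge
  -- with the roles of `u` and `v` exchanged; the backward edge from `u` to `v` is left over.
  refine lt_of_le_of_lt (card_le_card_of_injOn
    (fun q => if q.1 = v then (u, q.2) else if q.2 = u ∧ f q.1 < f u then (q.1, v) else q)
    ?_ ?_) (card_lt_card (erase_ssubset huvmem))
  · rintro ⟨x, y⟩ hq
    simp only [backEdges, mem_coe, mem_filter, mem_univ, true_and, mem_erase] at hq ⊢
    have := hcov y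
    have := h0 x
    have := T.irrefl x
    have hxv : T.beats x u → x ≠ v → T.beats x v := fun h h' =>
      (T.total x v h').resolve_right fun h'' => T.asymm x u h (hcov x h'')
    have hxu : f x = f u → x = u := fun h => hf h
    rw [hg' x, hg' y] at hq
    split_ifs <;> grind
  · rintro ⟨x, y⟩ hq ⟨x', y'⟩ hq' hqq
    simp only [backEdges, mem_coe, mem_filter, mem_univ, true_and] at hq hq' hqq
    rw [hg' x, hg' y] at hq
    rw [hg' x', hg' y'] at hq'
    split_ifs at hqq <;> grind

theorem isKingIn_of_mem_slaterSet {v : V} (hv : v ∈ T.slaterSet) : T.IsKingIn univ v := by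
  obtain ⟨T', hT', e, he, hev⟩ := hv
  refine isKingIn_univ_of_not_covered fun u huv hcov => ?_
  have hinj : Function.Injective fun w => (e w : ℕ) := fun x y h => e.injective (Fin.ext h)
  refine absurd (hT'.card_backEdges_le he (fun w => (e (Equiv.swap u v w) : ℕ))
    (hinj.comp (Equiv.injective _))) (not_le.2 ?_)
  refine card_backEdges_lt_of_covers huv hcov hinj hev (by simp) (by simp) fun w h h' => ?_
  rw [Equiv.swap_apply_of_ne_of_ne h h']

theorem card_le_of_mem_slaterSet {v : V} (hv : v ∈ T.slaterSet) :
    Fintype.card V ≤ 2 * T.outDegree v + 1 := by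
  obtain ⟨T', hT', e, he, hev⟩ := hv
  have hinj : Function.Injective fun w => (e w : ℕ) := fun x y h => e.injective (Fin.ext h)
  have hlt : ∀ w, (e w : ℕ) < Fintype.card V := fun w => (e w).isLt
  have h0 : ∀ w, w ≠ v → 0 < (e w : ℕ) := fun w hw =>
    Nat.pos_of_ne_zero fun h => hw (hinj (h.trans hev.symm))
  -- The ranking in which `v` is moved to the last place.
  set f : V → ℕ := fun w => if w = v then Fintype.card V else e w with hf
  have hmin := hT'.card_backEdges_le he f (fun x y hxy => by
    have := hlt x
    have := hlt y
    have := @hinj x y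
    grind)
  have hold : ({u | T.beats u v} : Finset V).image (fun u => (u, v)) =
      {q ∈ T.backEdges fun w => (e w : ℕ) | q.1 = v ∨ q.2 = v} := by
    ext ⟨x, y⟩
    have := h0 x
    have := T.irrefl v
    simp only [backEdges, mem_image, mem_filter, mem_univ, true_and, Prod.mk.injEq]
    grind
  have hnew : ({u | T.beats v u} : Finset V).image (fun u => (v, u)) =
      {q ∈ T.backEdges f | q.1 = v ∨ q.2 = v} := by
    ext ⟨x, y⟩
    have := hlt x
    have := hlt y
    have := T.irrefl v
    simp only [backEdges, mem_image, mem_filter, mem_univ, true_and, Prod.mk.injEq]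
    grind
  have hcommon : {q ∈ T.backEdges fun w => (e w : ℕ) | ¬ (q.1 = v ∨ q.2 = v)} =
      {q ∈ T.backEdges f | ¬ (q.1 = v ∨ q.2 = v)} := by
    ext ⟨x, y⟩
    simp only [backEdges, mem_filter, mem_univ, true_and]
    grind
  rw [← card_filter_add_card_filter_not (s := T.backEdges fun w => (e w : ℕ))
      (fun q => q.1 = v ∨ q.2 = v),
    ← card_filter_add_card_filter_not (s := T.backEdges f) (fun q => q.1 = v ∨ q.2 = v),
    ← hold, ← hnew, hcommon, card_image_of_injective _ (Prod.mk_left_injective v),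
    card_image_of_injective _ (Prod.mk_right_injective v)] at hmin
  have := T.card_losses_add_outDegree v
  rw [outDegree] at *
  omega

/-! ### Markov set -/

/-- The balance equation: the flow out of the state `v` equals the flow into it. -/
theorem IsStationary.balance {p : V → ℝ} (h : T.IsStationary p) (hn : Fintype.card V ≠ 1) (v : V) :
    ((Fintype.card V : ℝ) - 1 - T.outDegree v) * p v = ∑ w with T.beats v w, p w := by
  have hn' : (Fintype.card V : ℝ) - 1 ≠ 0 := by
    rw [sub_ne_zero]
    exact_mod_cast hn
  have h1 := congrFun h.2 v
  have h2 : ∀ w, T.markovMatrix v w * p w =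
      (if w = v then (T.outDegree v : ℝ) / ((Fintype.card V : ℝ) - 1) * p v else 0) +
        1 / ((Fintype.card V : ℝ) - 1) * (if T.beats v w then p w else 0) := by
    intro w
    by_cases hw : w = v
    · subst hw
      simp [markovMatrix, hn, T.irrefl]
    · simp [markovMatrix, hw, Ne.symm hw]
  simp only [Matrix.mulVec, dotProduct, h2, sum_add_distrib, sum_ite_eq', mem_univ, if_true,
    ← mul_sum] at h1
  rw [sum_filter]
  field_simp at h1
  linarith

theorem isKingIn_and_card_le_of_mem_markovSet {v : V} (hv : v ∈ T.markovSet) :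
    T.IsKingIn univ v ∧ Fintype.card V ≤ 2 * T.outDegree v + 1 := by
  obtain ⟨p, hp, hmax⟩ := hv
  have hpos : 0 < p v := by
    by_contra! hc
    have := sum_nonpos fun u (_ : u ∈ univ) => (hmax u).trans hc
    linarith [hp.1.2]
  by_cases hn : Fintype.card V = 1
  · refine ⟨fun u _ huv => ?_, by omega⟩
    have := Fintype.card_le_one_iff_subsingleton.1 hn.le
    exact absurd (Subsingleton.elim u v) huv
  have hv := hp.balance hn v
  refine ⟨isKingIn_univ_of_not_covered fun u huv hcov => ?_, ?_⟩
  · have hu := hp.balance hn u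
    have h1 : p v + ∑ w with T.beats v w, p w ≤ ∑ w with T.beats u w, p w := by
      rw [← sum_insert (by simp [T.irrefl])]
      refine sum_le_sum_of_subset_of_nonneg (fun w => ?_) fun w _ _ => hp.1.1 w
      simp only [mem_insert, mem_filter, mem_univ, true_and]
      rintro (rfl | h)
      exacts [huv, hcov w h]
    have h2 : (T.outDegree v : ℝ) ≤ T.outDegree u := by
      exact_mod_cast (outDegree_lt_of_covers huv hcov).le
    have h3 : (T.outDegree u : ℝ) + 1 ≤ Fintype.card V := by
      exact_mod_cast (by have := T.card_losses_add_outDegree u; omega)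
    have h4 := mul_le_mul_of_nonneg_left (hmax u)
      (by linarith : 0 ≤ (Fintype.card V : ℝ) - 1 - T.outDegree u)
    have h5 := mul_le_mul_of_nonneg_right h2 hpos.le
    linarith
  · have h1 : ∑ w with T.beats v w, p w ≤ T.outDegree v * p v := by
      simpa [outDegree] using sum_le_card_nsmul ({w | T.beats v w} : Finset V) p (p v)
        fun w _ => hmax w
    rw [← hv] at h1
    have h2 := le_of_mul_le_mul_right h1 hpos
    have h3 : (Fintype.card V : ℝ) ≤ 2 * T.outDegree v + 1 := by linarith
    exact_mod_cast h3

/-! ### Bipartisan set -/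

theorem payoff_single (T : Tournament V) (u : V) (p : V → ℝ) :
    T.payoff (Pi.single u 1) p = ∑ w, T.payoffMatrix u w * p w := by
  unfold payoff
  rw [sum_eq_single u (fun i _ hi => by simp [Pi.single_eq_of_ne hi]) (by simp)]
  simp

theorem payoff_self (T : Tournament V) (p : V → ℝ) : T.payoff p p = 0 := by
  have h : T.payoff p p = - T.payoff p p := by
    conv_lhs => rw [payoff, sum_comm]
    simp_rw [payoff, ← sum_neg_distrib]
    refine sum_congr rfl fun u _ => sum_congr rfl fun w _ => ?_
    rw [T.payoffMatrix_swap]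
    ring
  linarith

theorem IsMaximalLottery.sum_payoffMatrix_mul_nonpos {p : V → ℝ} (hp : T.IsMaximalLottery p)
    (u : V) : ∑ w, T.payoffMatrix u w * p w ≤ 0 := by
  rw [← payoff_single, ← T.payoff_self p]
  exact hp.2.2.1 _ (single_mem_stdSimplex ℝ u)

/-- Complementary slackness: every player in the support of a maximal lottery `p` is a best
response to `p`. -/
theorem IsMaximalLottery.sum_payoffMatrix_mul_eq_zero {p : V → ℝ} (hp : T.IsMaximalLottery p)
    {v : V} (hv : 0 < p v) : ∑ w, T.payoffMatrix v w * p w = 0 := by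
  have h0 : ∑ u, p u * ∑ w, T.payoffMatrix u w * p w = 0 := by
    rw [← T.payoff_self p, payoff]
    simp_rw [mul_sum, mul_assoc]
  have h1 := (sum_eq_zero_iff_of_nonpos fun u _ =>
    mul_nonpos_of_nonneg_of_nonpos (hp.1.1 u) (hp.sum_payoffMatrix_mul_nonpos u)).1 h0 v
      (mem_univ v)
  exact (mul_eq_zero.1 h1).resolve_left hv.ne'

theorem isKingIn_of_mem_bipartisanSet {v : V} (hv : v ∈ T.bipartisanSet) :
    T.IsKingIn univ v := by
  obtain ⟨p, hp, hpv⟩ := hv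
  refine isKingIn_univ_of_not_covered fun u huv hcov => ?_
  have h1 := hp.sum_payoffMatrix_mul_nonpos u
  rw [← hp.sum_payoffMatrix_mul_eq_zero hpv] at h1
  refine absurd h1 (not_le.2 (sum_lt_sum (fun w _ => ?_) ⟨v, mem_univ v, ?_⟩))
  · refine mul_le_mul_of_nonneg_right ?_ (hp.1.1 w)
    have := hcov w
    have := T.total v w
    unfold payoffMatrix
    by_cases hw : v = w
    · subst hw
      simp [huv, T.irrefl]
    · split_ifs <;> first | tauto | norm_num
  · simpa [payoffMatrix, T.irrefl, huv] using hpv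

theorem IsMaximalLottery.exists_card_le {p : V → ℝ} (hp : T.IsMaximalLottery p) :
    ∃ v, 0 < p v ∧ Fintype.card V ≤ 2 * T.outDegree v + 1 := by
  by_contra! hc
  -- The expected payoff of `p`, summed over all opponents, is nonnegative.
  have h1 : 0 ≤ ∑ u, p u * ∑ w, T.payoffMatrix u w := by
    simp_rw [mul_sum]
    rw [sum_comm]
    refine sum_nonneg fun w _ => ?_
    have := hp.sum_payoffMatrix_mul_nonpos w
    rw [← neg_nonneg, ← sum_neg_distrib] at this
    refine this.trans_eq (sum_congr rfl fun u _ => ?_)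
    rw [T.payoffMatrix_swap]
    ring
  obtain ⟨v, hv⟩ : ∃ v, 0 < p v := by
    by_contra! h
    have := sum_nonpos fun u (_ : u ∈ univ) => h u
    linarith [hp.1.2]
  have hneg : ∀ u, 0 < p u → ∑ w, T.payoffMatrix u w < 0 := by
    intro u hu
    have h2 : ((2 * T.outDegree u + 1 : ℕ) : ℝ) < Fintype.card V := by exact_mod_cast hc u hu
    rw [sum_payoffMatrix]
    push_cast at h2
    linarith
  refine absurd h1 (not_le.2 (sum_neg' (fun u _ => ?_) ⟨v, mem_univ v, ?_⟩))
  · rcases (hp.1.1 u).eq_or_lt with h | h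
    · simp [← h]
    · exact (mul_neg_of_pos_of_neg h (hneg u h)).le
  · exact mul_neg_of_pos_of_neg hv (hneg v hv)

end Tournament

theorem theorem3p1 {V : Type*} [Fintype V] (k : ℕ) (hV : Fintype.card V = 2 ^ k)
    (T : Tournament V) :
    (∀ v ∈ T.copelandSet, T.IsSEWinner v) ∧
    (∀ v ∈ T.slaterSet, T.IsSEWinner v) ∧
    (∀ v ∈ T.markovSet, T.IsSEWinner v) ∧
    (∀ v ∈ T.bipartisanSet, (∀ u ∈ T.bipartisanSet, T.outDegree u ≤ T.outDegree v) →
      T.IsSEWinner v) := by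
  refine ⟨fun v hv => ?_, fun v hv => ?_, fun v hv => ?_, fun v hv hmax => ?_⟩
  · exact Tournament.isSEWinner_of_isKingIn hV (Tournament.isKingIn_of_mem_copelandSet hv)
      (Tournament.card_le_of_mem_copelandSet hv)
  · exact Tournament.isSEWinner_of_isKingIn hV (Tournament.isKingIn_of_mem_slaterSet hv)
      (Tournament.card_le_of_mem_slaterSet hv)
  · obtain ⟨hk, ho⟩ := Tournament.isKingIn_and_card_le_of_mem_markovSet hv
    exact Tournament.isSEWinner_of_isKingIn hV hk ho
  · refine Tournament.isSEWinner_of_isKingIn hV (Tournament.isKingIn_of_mem_bipartisanSet hv) ?_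
    obtain ⟨p, hp, -⟩ := id hv
    obtain ⟨u, hu, huc⟩ := hp.exists_card_le
    have := hmax u ⟨p, hp, hu⟩
    omega
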